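/- Let $q$ be a prime power, $n,d,k$ positive integers, and $f_1,\dots,f_k\in\mathbb F_q[x_1,\dots,x_n]$ polynomials of total degree at most $d$ whose common zero set defines an affine variety $V$ of co-dimension $k$, that is, the common zero set over $\overline{\mathbb F}_q$ has dimension $n-k$. We say that a $k$-dimensional affine subspace $A$ of $\mathbb F_q^n$ properly intersects $V$ if $V\cap A$ contains a point of $\mathbb F_q^n$ and has dimension zero (as a variety over $\overline{\mathbb F}_q$). There is a function $B(n,d,k)$, independent of $q$ (and of $V$ and $v$ below) and, for every fixed $k$, bounded by a polynomial in $n$ and $d$, such that for all such $q,n,d,k$ and $f_1,\dots,f_k$, and for every $\mathbb F_q$-rational point $v\in V$, the fraction of the $k$-dimensional affine subspaces of $\mathbb F_q^n$ passing through $v$ that properly intersect $V$ is at least $1-B(n,d,k)/q$. -/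

import Mathlib

namespace VarietySampling

/-- The points with coordinates in `K` of the affine variety cut out by polynomials `f₁, …, f_k`
with coefficients in the subfield `F`. For `K = F` these are the rational points, for `K` an
algebraic closure of `F` the geometric points. -/
def points {F : Type*} [Field F] (K : Type*) [Field K] [Algebra F K] {n k : ℕ}
    (f : Fin k → MvPolynomial (Fin n) F) : Set (Fin n → K) :=
  {x | ∀ i, MvPolynomial.aeval x (f i) = 0}

/-- The dimension of an algebraic subset `S` of affine `n`-space over an algebraically closed
field `K`: the Krull dimension of its coordinate ring `K[x₁, …, xₙ] / I(S)`.
It is `⊥` for the empty set. -/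
noncomputable def dimension {K : Type*} [Field K] {n : ℕ} (S : Set (Fin n → K)) :
    WithBot ℕ∞ :=
  ringKrullDim (MvPolynomial (Fin n) K ⧸ MvPolynomial.vanishingIdeal K S)

/-- The extension of scalars of an affine subspace `A` of `Fⁿ`: the affine subspace of `Kⁿ`
spanned by the points of `A`, that is, the one given by the same linear equations. -/
def baseChange {F : Type*} [Field F] (K : Type*) [Field K] [Algebra F K] {n : ℕ}
    (A : AffineSubspace F (Fin n → F)) : AffineSubspace K (Fin n → K) :=
  affineSpan K ((fun x : Fin n → F => fun i => algebraMap F K (x i)) '' (A : Set (Fin n → F)))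

/-- The variety defined by `f₁, …, f_k` in `n`-space has co-dimension `c`. -/
def HasCodimension {F : Type*} [Field F] {n k : ℕ}
    (f : Fin k → MvPolynomial (Fin n) F) (c : ℕ) : Prop :=
  dimension (points (AlgebraicClosure F) f) + (c : WithBot ℕ∞) = (n : WithBot ℕ∞)

/-- The affine subspace `A` of `Fⁿ` properly intersects the variety `V` defined by `f₁, …, f_k`:
`V ∩ A` has a rational point and its dimension (over the algebraic closure) is zero. -/
def ProperlyIntersects {F : Type*} [Field F] {n k : ℕ}
    (A : AffineSubspace F (Fin n → F)) (f : Fin k → MvPolynomial (Fin n) F) : Prop :=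
  (points F f ∩ (A : Set (Fin n → F))).Nonempty ∧
    dimension (points (AlgebraicClosure F) f ∩
      (baseChange (AlgebraicClosure F) A : Set (Fin n → AlgebraicClosure F))) = 0

/-- The `k`-dimensional affine subspaces of `Fⁿ` that pass through `v`. -/
def spacesThrough {F : Type*} [Field F] {n : ℕ} (k : ℕ) (v : Fin n → F) :
    Set (AffineSubspace F (Fin n → F)) :=
  {A | v ∈ A ∧ Module.finrank F A.direction = k}

end VarietySampling

open MvPolynomial

/-! ### Dimension theory of affine domains over a field. -/

section KrullDimension

/-! A `k`-dimensional subspace through `v` is cut out by `r = n - k` independent linear forms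
vanishing at `v`. Choose the forms one at a time, and call a choice good if the forms stay
independent and every component of the cut has at most the expected dimension. A new form spoils a
good choice only if it lies in the span of the earlier ones or vanishes on a component of exactly
the expected dimension. That dimension is still positive, so such a component is not the point `v`,
and the forms vanishing on it make up a proper subspace of the dual: at most a fraction `1/q` of all
forms. By Bézout there are at most `d ^ k` such components, since hyperplanes do not increase the
product of the degrees. A union bound over the `r` choices (`card_not_isProperCut_snoc_mul_le`,
`card_filter_not_mul_le`) makes at most a fraction `r (d ^ k + 1) / q` of the tuples bad. Every
subspace arises from the same number of independent tuples, so the bound passes from tuples to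
subspaces, and `B = n (d ^ k + 1)` works.

Bézout (`card_le_prod_totalDegree`) rests on affine Hilbert functions. Cutting by a nonzerodivisor
of degree at most `d` bounds the summed Hilbert function of the cut by `d` times the old one. After
`k` cuts the `k`-fold sum is at most the product of the degrees times that of the full polynomial
ring, while each component of dimension `m - k` contributes the same leading term once. -/

theorem ringKrullDim_le_of_isIntegral (A B : Type*) [CommRing A] [CommRing B] [Algebra A B]
    [Algebra.IsIntegral A B] : ringKrullDim B ≤ ringKrullDim A :=
  Order.krullDim_le_of_strictMono (PrimeSpectrum.comap (algebraMap A B)) fun P Q h =>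
    Ideal.IsIntegral.comap_lt_comap (R := A) (I := P.asIdeal) (J := Q.asIdeal) h

/-- Lying over lifts the bottom of a chain of primes, and going up lifts the rest. -/
theorem ringKrullDim_le_of_isIntegral_of_injective (A B : Type*) [CommRing A] [CommRing B]
    [Algebra A B] [Algebra.IsIntegral A B] (h : Function.Injective (algebraMap A B)) :
    ringKrullDim A ≤ ringKrullDim B := by
  refine iSup_le fun l => ?_
  obtain ⟨P, -, hP, hPl⟩ := Ideal.exists_ideal_over_prime_of_isIntegral (S := B)
    (RelSeries.head l).asIdeal ⊥ (by
      rw [← RingHom.ker_eq_comap_bot, (RingHom.injective_iff_ker_eq_bot _).mp h]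
      exact bot_le)
  have : P.LiesOver (RelSeries.head l).asIdeal := ⟨hPl.symm⟩
  obtain ⟨L, hL, -⟩ := Ideal.exists_ltSeries_of_hasGoingUp l P
  rw [← hL]
  exact le_iSup (fun L : LTSeries (PrimeSpectrum B) => (L.length : WithBot ℕ∞)) L

variable {K : Type*} [Field K]

/-- Induction on the number of variables: by the Jacobson property a maximal ideal of `R[X]`
contracts to a maximal ideal of `R`, and the height goes up by one. -/
theorem MvPolynomial.height_eq_of_isMaximal {s : ℕ} (M : Ideal (MvPolynomial (Fin s) K))
    [hM : M.IsMaximal] : M.height = s := by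
  induction s with
  | zero =>
    have h := Ideal.height_le_ringKrullDim_of_ne_top (I := M) hM.ne_top
    rw [MvPolynomial.ringKrullDim_of_isNoetherianRing, ringKrullDim_eq_zero_of_field] at h
    simpa using h
  | succ s ih =>
    let e := (MvPolynomial.finSuccEquiv K s).toRingEquiv
    have hM' : (M.map e).IsMaximal := Ideal.map_isMaximal_of_equiv e
    have hu : ((M.map e).under (MvPolynomial (Fin s) K)).IsMaximal :=
      Polynomial.isMaximal_comap_C_of_isJacobsonRing _
    have hover : (M.map e).LiesOver ((M.map e).under (MvPolynomial (Fin s) K)) := ⟨rfl⟩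
    rw [← e.height_map M,
      Polynomial.height_eq_height_add_one ((M.map e).under (MvPolynomial (Fin s) K)) (M.map e), ih]
    simp

/-- By unique factorization such a prime is principal, and dividing by one element lowers the height
of a maximal ideal above it, which is `s`, by at most one. -/
theorem MvPolynomial.le_ringKrullDim_quotient_add_one {s : ℕ}
    (p : Ideal (MvPolynomial (Fin s) K)) [hp : p.IsPrime] (h : p.height ≤ 1) :
    (s : WithBot ℕ∞) ≤ ringKrullDim (MvPolynomial (Fin s) K ⧸ p) + 1 := by
  obtain ⟨M, hM, hpM⟩ := Ideal.exists_le_maximal p hp.ne_top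
  have hprin : ∃ a, p = Ideal.span {a} := by
    by_cases h0 : p = ⊥
    · exact ⟨0, by simp [h0]⟩
    obtain ⟨a, hap, ha⟩ := hp.exists_mem_prime_of_ne_bot h0
    refine ⟨a, ?_⟩
    have hle : Ideal.span {a} ≤ p := (Ideal.span_singleton_le_iff_mem _).2 hap
    have hpr : (Ideal.span {a}).IsPrime := (Ideal.span_singleton_prime ha.ne_zero).2 ha
    by_contra hne
    have hlt : Ideal.span {a} < p := lt_of_le_of_ne hle (Ne.symm hne)
    have hlt0 : (⊥ : Ideal (MvPolynomial (Fin s) K)) < Ideal.span {a} := by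
      rw [bot_lt_iff_ne_bot, Ne, Ideal.span_singleton_eq_bot]
      exact ha.ne_zero
    have h1 := Ideal.height_add_one_le_of_lt_of_isPrime hlt
    have h2 := Ideal.height_add_one_le_of_lt_of_isPrime hlt0
    have h3 : (1 : ℕ∞) + 1 ≤ 1 := by
      refine le_trans ?_ (h1.trans h)
      gcongr
      exact le_trans (by simp) h2
    exact absurd h3 (by decide)
  obtain ⟨a, rfl⟩ := hprin
  have := Ideal.height_le_ringKrullDim_quotient_add_one (r := a) (p := M)
    (hpM (Ideal.mem_span_singleton_self a))
  rwa [MvPolynomial.height_eq_of_isMaximal M] at this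

variable {m : ℕ}

/-- All three clauses come from one Noether normalization, a finite injection of a polynomial ring
in `s` variables into the coordinate ring. -/
theorem exists_ringKrullDim_eq_and_algebraicIndependent (P : Ideal (MvPolynomial (Fin m) K))
    [hP : P.IsPrime] : ∃ s : ℕ, ringKrullDim (MvPolynomial (Fin m) K ⧸ P) = s ∧
      (∃ σ : Fin s → Fin m, AlgebraicIndependent K fun i => Ideal.Quotient.mk P (X (σ i))) ∧
      ∀ P' : Ideal (MvPolynomial (Fin m) K), P ≤ P' → P'.IsPrime →
        (P'.map (Ideal.Quotient.mk P)).height ≤ 1 →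
        (s : WithBot ℕ∞) ≤ ringKrullDim (MvPolynomial (Fin m) K ⧸ P') + 1 := by
  obtain ⟨s, -, g, hinj, hint⟩ := exists_integral_inj_algHom_of_quotient P hP.ne_top
  let B := MvPolynomial (Fin m) K ⧸ P
  let A := MvPolynomial (Fin s) K
  let _ : Algebra A B := g.toRingHom.toAlgebra
  have hint' : Algebra.IsIntegral A B := ⟨hint⟩
  have hinj' : Function.Injective (algebraMap A B) := hinj
  have : IsScalarTower K A B := IsScalarTower.of_algebraMap_eq fun x => (g.commutes x).symm
  have hfaith : FaithfulSMul A B := (faithfulSMul_iff_algebraMap_injective A B).2 hinj'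
  have hdim : ringKrullDim B = s := by
    have hA : ringKrullDim A = s := by
      rw [MvPolynomial.ringKrullDim_of_isNoetherianRing, ringKrullDim_eq_zero_of_field]
      simp
    exact le_antisymm (hA ▸ ringKrullDim_le_of_isIntegral A B)
      (hA ▸ ringKrullDim_le_of_isIntegral_of_injective A B hinj')
  refine ⟨s, hdim, ?_, ?_⟩
  · have hb : IsTranscendenceBasis K (algebraMap A B ∘ (X : Fin s → A)) :=
      (IsTranscendenceBasis.mvPolynomial (Fin s) K).algebraMap_comp
    let x : Fin m → B := fun i => Ideal.Quotient.mk P (X i)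
    have htop : Algebra.adjoin K (Set.range x) = ⊤ := by
      have hx : Set.range x = Ideal.Quotient.mkₐ K P '' Set.range X := by
        rw [← Set.range_comp]; rfl
      rw [hx, ← AlgHom.map_adjoin, MvPolynomial.adjoin_range_X, Algebra.map_top]
      exact (AlgHom.range_eq_top _).2 (Ideal.Quotient.mkₐ_surjective K P)
    have halg : Algebra.IsAlgebraic (Algebra.adjoin K (Set.range x)) B := by
      rw [htop]
      exact ⟨fun b => isAlgebraic_algebraMap (⟨b, trivial⟩ : (⊤ : Subalgebra K B))⟩
    -- The coordinate functions generate, so they contain a transcendence basis; it has as many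
    -- elements as the one given by the normalization.
    obtain ⟨t, htx, ht⟩ := exists_isTranscendenceBasis_subset (R := K) (Set.range x)
    have hfin : Finite t := (Set.finite_range x).subset htx
    have hcard : Nat.card t = s := by
      have := congrArg Cardinal.toNat (ht.lift_cardinalMk_eq hb)
      rw [Nat.card]
      simpa using this
    let e : Fin s ≃ t := (finCongr hcard.symm).trans (Finite.equivFin t).symm
    choose τ hτ using fun i : Fin s => htx (e i).2
    refine ⟨τ, ?_⟩
    have hind := ht.1.comp e e.injective
    convert hind using 1
    funext i
    exact hτ i
  · intro P' hPP' hP' hht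
    let p' : Ideal B := P'.map (Ideal.Quotient.mk P)
    have hp' : p'.IsPrime := Ideal.isPrime_map_quotientMk_of_isPrime hPP'
    let p : Ideal A := p'.under A
    have hp : p.IsPrime := inferInstance
    -- Going down holds over the normal domain `A`, so contraction does not raise the height.
    have hh : p.height ≤ 1 := by
      have := Ideal.height_eq_height_add_of_liesOver_of_hasGoingDown p p'
      exact le_trans (by rw [this]; exact le_self_add) hht
    refine (MvPolynomial.le_ringKrullDim_quotient_add_one p hh).trans ?_
    gcongr
    refine (ringKrullDim_le_of_isIntegral_of_injective (A ⧸ p) (B ⧸ p')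
      Ideal.algebraMap_quotient_injective).trans ?_
    exact (ringKrullDim_eq_of_ringEquiv (DoubleQuot.quotQuotEquivQuotOfLE hPP')).le

/-- The Krull dimension of the coordinate ring of a prime ideal, as a natural number. -/
noncomputable def primeDim (P : Ideal (MvPolynomial (Fin m) K)) : ℕ :=
  ((ringKrullDim (MvPolynomial (Fin m) K ⧸ P)).unbotD 0).toNat

theorem coe_primeDim (P : Ideal (MvPolynomial (Fin m) K)) [P.IsPrime] :
    (primeDim P : WithBot ℕ∞) = ringKrullDim (MvPolynomial (Fin m) K ⧸ P) := by
  obtain ⟨s, hs, -⟩ := exists_ringKrullDim_eq_and_algebraicIndependent P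
  rw [primeDim, hs]
  rfl

theorem primeDim_bot : primeDim (⊥ : Ideal (MvPolynomial (Fin m) K)) = m := by
  have h := coe_primeDim (⊥ : Ideal (MvPolynomial (Fin m) K))
  rw [ringKrullDim_eq_of_ringEquiv (RingEquiv.quotientBot _),
    MvPolynomial.ringKrullDim_of_isNoetherianRing, ringKrullDim_eq_zero_of_field] at h
  simp only [Nat.card_eq_fintype_card, Fintype.card_fin, zero_add] at h
  exact_mod_cast h

theorem primeDim_lt_of_lt {P Q : Ideal (MvPolynomial (Fin m) K)} [hP : P.IsPrime]
    [hQ : Q.IsPrime] (h : P < Q) : primeDim Q < primeDim P := by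
  obtain ⟨a, haQ, haP⟩ := SetLike.exists_of_lt h
  have := ringKrullDim_succ_le_of_surjective (Ideal.Quotient.factor h.le)
    (Ideal.Quotient.factor_surjective h.le) (r := Ideal.Quotient.mk P a)
    (mem_nonZeroDivisors_of_ne_zero (by rwa [Ne, Ideal.Quotient.eq_zero_iff_mem]))
    (by rwa [Ideal.Quotient.factor_mk, Ideal.Quotient.eq_zero_iff_mem])
  rw [← coe_primeDim, ← coe_primeDim] at this
  exact_mod_cast this

theorem exists_algebraicIndependent_of_primeDim (P : Ideal (MvPolynomial (Fin m) K))
    [P.IsPrime] : ∃ σ : Fin (primeDim P) → Fin m,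
      AlgebraicIndependent K fun i => Ideal.Quotient.mk P (X (σ i)) := by
  obtain ⟨s, hs, h, -⟩ := exists_ringKrullDim_eq_and_algebraicIndependent P
  have : primeDim P = s := by
    rw [← coe_primeDim] at hs
    exact_mod_cast hs
  rwa [this]

theorem primeDim_le_add_one_of_mem_minimalPrimes {P P' : Ideal (MvPolynomial (Fin m) K)}
    [P.IsPrime] {g : MvPolynomial (Fin m) K} (h : P' ∈ (P ⊔ Ideal.span {g}).minimalPrimes) :
    primeDim P ≤ primeDim P' + 1 := by
  have hP' : P'.IsPrime := h.1.1
  obtain ⟨s, hs, -, h'⟩ := exists_ringKrullDim_eq_and_algebraicIndependent P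
  have := h' P' (le_sup_left.trans h.1.2) hP'
    (Ideal.map_height_le_one_of_mem_minimalPrimes h)
  rw [← hs, ← coe_primeDim, ← coe_primeDim] at this
  exact_mod_cast this

/-- Krull's principal ideal theorem, one equation at a time: below `Q` there is a component of the
first cut, and `Q` remains minimal over that component and the other equations. -/
theorem primeDim_le_add_card_of_mem_minimalPrimes (S : Finset (MvPolynomial (Fin m) K))
    {P Q : Ideal (MvPolynomial (Fin m) K)} [P.IsPrime]
    (h : Q ∈ (P ⊔ Ideal.span (S : Set (MvPolynomial (Fin m) K))).minimalPrimes) :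
    primeDim P ≤ primeDim Q + S.card := by
  classical
  induction S using Finset.induction_on generalizing P with
  | empty =>
    have : Q = P := by
      simpa [Ideal.minimalPrimes_eq_subsingleton_self] using h
    simp [this]
  | insert g S hg ih =>
    have hQ : Q.IsPrime := h.1.1
    rw [Finset.coe_insert, Ideal.span_insert, ← sup_assoc] at h
    obtain ⟨P₁, hP₁, hP₁Q⟩ := Ideal.exists_minimalPrimes_le (le_sup_left.trans h.1.2)
    have : P₁.IsPrime := hP₁.1.1
    have h₁ := primeDim_le_add_one_of_mem_minimalPrimes hP₁
    have h₂ := ih (P := P₁) ⟨⟨hQ, sup_le hP₁Q (le_sup_right.trans h.1.2)⟩, fun J hJ hJQ =>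
      h.2 ⟨hJ.1, (sup_le_sup_right hP₁.1.2 _).trans hJ.2⟩ hJQ⟩
    rw [Finset.card_insert_of_notMem hg]
    omega

end KrullDimension

/-! ### Affine Hilbert functions. -/

section HilbertFunction

variable {K : Type*} [Field K] {m : ℕ}

theorem finrank_map_of_injective {V W : Type*} [AddCommGroup V] [Module K V] [AddCommGroup W]
    [Module K W] {f : V →ₗ[K] W} (hf : Function.Injective f) (U : Submodule K V) :
    Module.finrank K (U.map f) = Module.finrank K U :=
  (Submodule.equivMapOfInjective f hf U).finrank_eq.symm

/-- The dimension of the space of polynomials of degree at most `t`, modulo the subspace `W`. -/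
noncomputable def hilbertFn (W : Submodule K (MvPolynomial (Fin m) K)) (t : ℕ) : ℕ :=
  Module.finrank K ((restrictTotalDegree (Fin m) K t).map W.mkQ)

theorem restrictTotalDegree_mono {s t : ℕ} (h : s ≤ t) :
    restrictTotalDegree (Fin m) K s ≤ restrictTotalDegree (Fin m) K t := fun p hp => by
  rw [mem_restrictTotalDegree] at hp ⊢
  exact hp.trans h

theorem hilbertFn_mono (W : Submodule K (MvPolynomial (Fin m) K)) : Monotone (hilbertFn W) :=
  fun _ _ h => Submodule.finrank_mono (Submodule.map_mono (restrictTotalDegree_mono h))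

/-- If multiplication by `e ∈ J` embeds the quotient by `Q` into the quotient by `I ≤ J`, then the
quotients by `J` and `Q` together are no larger than the quotient by `I`. -/
theorem hilbertFn_add_le {I J Q : Submodule K (MvPolynomial (Fin m) K)} (hIJ : I ≤ J)
    (e : MvPolynomial (Fin m) K) {c : ℕ} (hc : e.totalDegree ≤ c) (heJ : ∀ a, e * a ∈ J)
    (heQ : ∀ a, e * a ∈ I ↔ a ∈ Q) (t : ℕ) :
    hilbertFn J (t + c) + hilbertFn Q t ≤ hilbertFn I (t + c) := by
  let φ : (MvPolynomial (Fin m) K ⧸ I) →ₗ[K] (MvPolynomial (Fin m) K ⧸ J) :=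
    Submodule.mapQ I J LinearMap.id (by simpa using hIJ)
  let ψ : (MvPolynomial (Fin m) K ⧸ Q) →ₗ[K] (MvPolynomial (Fin m) K ⧸ I) :=
    Submodule.mapQ Q I (LinearMap.mulLeft K e) fun a ha => by simpa using (heQ a).2 ha
  have hψ : Function.Injective ψ := by
    rw [← LinearMap.ker_eq_bot, LinearMap.ker_eq_bot']
    intro x hx
    obtain ⟨a, rfl⟩ := Q.mkQ_surjective x
    have : e * a ∈ I := by simpa [ψ] using hx
    simpa using (heQ a).1 this
  set U := (restrictTotalDegree (Fin m) K (t + c)).map I.mkQ with hU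
  set Z := (restrictTotalDegree (Fin m) K t).map Q.mkQ with hZ
  have hUJ : U.map φ = (restrictTotalDegree (Fin m) K (t + c)).map J.mkQ := by
    rw [hU, ← Submodule.map_comp]
    rfl
  -- Multiples of `e` by polynomials of degree at most `t` have degree at most `t + c` and die
  -- modulo `J`; rank-nullity finishes.
  have hker : Module.finrank K Z ≤ Module.finrank K (LinearMap.ker (φ.domRestrict U)) := by
    rw [← finrank_map_of_injective hψ,
      ← finrank_map_of_injective U.injective_subtype (LinearMap.ker (φ.domRestrict U))]
    refine Submodule.finrank_mono ?_
    rintro _ ⟨_, ⟨a, ha, rfl⟩, rfl⟩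
    have ha' : a.totalDegree ≤ t := (mem_restrictTotalDegree _ _ _).1 ha
    refine ⟨⟨I.mkQ (e * a), e * a, ?_, rfl⟩, ?_, rfl⟩
    · refine (mem_restrictTotalDegree _ _ _).2 ((totalDegree_mul _ _).trans ?_)
      omega
    · simpa [φ] using heJ a
  have hrank := LinearMap.finrank_range_add_finrank_ker (φ.domRestrict U)
  rw [LinearMap.range_domRestrict, hUJ] at hrank
  change Module.finrank K ((restrictTotalDegree (Fin m) K (t + c)).map J.mkQ) +
    Module.finrank K Z ≤ Module.finrank K U
  omega

theorem hilbertFn_anti {I J : Submodule K (MvPolynomial (Fin m) K)} (hIJ : I ≤ J) (t : ℕ) :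
    hilbertFn J t ≤ hilbertFn I t := by
  have := hilbertFn_add_le (Q := ⊤) hIJ 0 (c := 0) (by simp) (by simp) (by simp) t
  simp only [add_zero] at this
  omega

/-- The partial sums of a sequence. -/
def partialSum (h : ℕ → ℕ) (t : ℕ) : ℕ := ∑ j ∈ Finset.range (t + 1), h j

theorem partialSum_mono {g h : ℕ → ℕ} (hgh : ∀ t, g t ≤ h t) (t : ℕ) :
    partialSum g t ≤ partialSum h t := Finset.sum_le_sum fun j _ => hgh j

theorem partialSum_mul (c : ℕ) (h : ℕ → ℕ) (t : ℕ) :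
    partialSum (fun j => c * h j) t = c * partialSum h t := (Finset.mul_sum ..).symm

/-- As `g` is a nonzerodivisor modulo `I`, the value for `J` at `t + d` is at most the increment of
the function of `I` from `t` to `t + d`. Summing in blocks of length `d` telescopes. -/
theorem partialSum_hilbertFn_le {I J : Submodule K (MvPolynomial (Fin m) K)} (hIJ : I ≤ J)
    (g : MvPolynomial (Fin m) K) {d : ℕ} (hd : g.totalDegree ≤ d) (hpos : 0 < d)
    (hgJ : ∀ a, g * a ∈ J) (hgI : ∀ a, g * a ∈ I ↔ a ∈ I) (t : ℕ) :
    partialSum (hilbertFn J) t ≤ d * hilbertFn I t := by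
  induction t using Nat.strong_induction_on with
  | _ t ih =>
    by_cases htd : t < d
    · calc partialSum (hilbertFn J) t ≤ ∑ j ∈ Finset.range (t + 1), hilbertFn J t :=
            Finset.sum_le_sum fun j hj => hilbertFn_mono J (by simp at hj; omega)
        _ = (t + 1) * hilbertFn J t := by simp
        _ ≤ d * hilbertFn I t := Nat.mul_le_mul htd (hilbertFn_anti hIJ t)
    · obtain ⟨s, rfl⟩ : ∃ s, t = s + d := ⟨t - d, by omega⟩
      have h₁ := ih s (by omega)
      have h₂ := hilbertFn_add_le hIJ g hd hgJ hgI s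
      have h₃ : partialSum (hilbertFn J) (s + d) ≤
          partialSum (hilbertFn J) s + d * hilbertFn J (s + d) := by
        unfold partialSum
        rw [show s + d + 1 = (s + 1) + d by ring, Finset.sum_range_add]
        gcongr
        calc ∑ x ∈ Finset.range d, hilbertFn J (s + 1 + x)
            ≤ ∑ x ∈ Finset.range d, hilbertFn J (s + d) :=
              Finset.sum_le_sum fun j hj => hilbertFn_mono J (by simp at hj; omega)
          _ = d * hilbertFn J (s + d) := by simp
      nlinarith

theorem partialSum_shift_le (h : ℕ → ℕ) (c t : ℕ) :
    partialSum (fun j => h (j + c)) t ≤ partialSum h (t + c) := by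
  have : partialSum h (t + c) = ∑ j ∈ Finset.range c, h j + partialSum (fun j => h (j + c)) t := by
    simp only [partialSum, add_comm _ c, add_assoc, Finset.sum_range_add h c (t + 1)]
  rw [this]
  exact Nat.le_add_left _ _

theorem partialSum_choose (m t : ℕ) :
    partialSum (fun j => (j + m).choose m) t = (t + (m + 1)).choose (m + 1) := by
  unfold partialSum
  rw [Nat.sum_range_add_choose, add_assoc]

theorem finrank_restrictTotalDegree (m t : ℕ) :
    Module.finrank K (restrictTotalDegree (Fin m) K t) = (t + m).choose m := by
  have hset : {n : Fin m →₀ ℕ | (n.sum fun _ e => e) ≤ t} =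
      (((Finset.range (t + 1)).biUnion fun j => Finset.univ.finsuppAntidiag j :
        Finset (Fin m →₀ ℕ)) : Set (Fin m →₀ ℕ)) := by
    ext n
    simp [Finset.mem_finsuppAntidiag, Finsupp.sum_fintype]
  rw [restrictTotalDegree, Module.finrank_eq_nat_card_basis (basisRestrictSupport K _), hset,
    Nat.card_coe_set_eq, Set.ncard_coe_finset, Finset.card_biUnion]
  · simp_rw [Finset.card_finsuppAntidiag_nat_eq_choose]
    clear hset
    induction t with
    | zero => simp
    | succ t ih =>
      rw [Finset.sum_range_succ, ih, Finset.card_univ, Fintype.card_fin,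
        ← Nat.choose_symm_add (a := t), ← Nat.choose_symm_add (a := t + 1), Nat.add_right_comm t 1 m,
        Nat.choose_succ_succ, show m + (t + 1) - 1 = t + m by omega]
  · intro i _ j _ hij
    rw [Function.onFun, Finset.disjoint_left]
    intro n hi hj
    rw [Finset.mem_finsuppAntidiag] at hi hj
    exact hij (hi.1.symm.trans hj.1)

theorem hilbertFn_bot (t : ℕ) :
    hilbertFn (⊥ : Submodule K (MvPolynomial (Fin m) K)) t = (t + m).choose m := by
  rw [hilbertFn, finrank_map_of_injective, finrank_restrictTotalDegree]
  rw [← LinearMap.ker_eq_bot, Submodule.ker_mkQ]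

/-- Polynomials in the independent coordinates inject into the quotient without a change of degree.
-/
theorem choose_le_hilbertFn {s : ℕ} (P : Ideal (MvPolynomial (Fin m) K)) (σ : Fin s → Fin m)
    (h : AlgebraicIndependent K fun i => Ideal.Quotient.mk P (X (σ i))) (t : ℕ) :
    (t + s).choose s ≤ hilbertFn (P.restrictScalars K) t := by
  rw [← finrank_restrictTotalDegree (K := K), hilbertFn]
  let g : MvPolynomial (Fin s) K →ₗ[K] (MvPolynomial (Fin m) K ⧸ P.restrictScalars K) :=
    (P.restrictScalars K).mkQ ∘ₗ (rename σ).toLinearMap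
  have hg : Function.Injective g := by
    rw [← LinearMap.ker_eq_bot, LinearMap.ker_eq_bot']
    intro p hp
    have hp' : rename σ p ∈ P := by simpa [g] using hp
    refine h.eq_zero_of_aeval_eq_zero p ?_
    rw [← Ideal.Quotient.eq_zero_iff_mem] at hp'
    rw [← hp', ← Ideal.Quotient.mkₐ_eq_mk K, rename_eq_aeval, ← AlgHom.comp_apply, comp_aeval]
    rfl
  rw [← finrank_map_of_injective hg]
  refine Submodule.finrank_mono ?_
  rintro _ ⟨p, hp, rfl⟩
  refine ⟨rename σ p, ?_, rfl⟩
  have hp' : p.totalDegree ≤ t := (mem_restrictTotalDegree _ _ _).1 hp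
  exact (mem_restrictTotalDegree _ _ _).2 ((totalDegree_rename_le σ p).trans hp')

end HilbertFunction

/-! ### Bézout's inequality. -/

section Bezout

variable {K : Type*} [Field K] {m : ℕ}

/-- Hilbert functions of incomparable primes add up, up to a shift: some `e` lies in all the earlier
primes but not in the new `Q`, and multiplication by `e` embeds the quotient by `Q`. The shift
collects the degrees of these `e`. -/
theorem exists_card_mul_choose_le_hilbertFn (T : Finset (Ideal (MvPolynomial (Fin m) K))) (s : ℕ)
    (hprime : ∀ P ∈ T, P.IsPrime) (hincomp : ∀ P ∈ T, ∀ Q ∈ T, P ≤ Q → P = Q)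
    (hs : ∀ Q ∈ T, ∀ t, (t + s).choose s ≤ hilbertFn (Q.restrictScalars K) t) :
    ∃ c, ∀ t, T.card * (t + s).choose s ≤ hilbertFn ((T.inf id).restrictScalars K) (t + c) := by
  classical
  induction T using Finset.induction_on with
  | empty => exact ⟨0, by simp⟩
  | insert Q T hQT ih =>
    obtain ⟨c, hc⟩ := ih (fun P hP => hprime P (Finset.mem_insert_of_mem hP))
      (fun P hP Q hQ => hincomp P (Finset.mem_insert_of_mem hP) Q (Finset.mem_insert_of_mem hQ))
      (fun P hP => hs P (Finset.mem_insert_of_mem hP))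
    have hQ : Q.IsPrime := hprime Q (Finset.mem_insert_self Q T)
    have hle : ¬ T.inf id ≤ Q := by
      rw [Ideal.IsPrime.inf_le' hQ]
      rintro ⟨P, hP, hPQ⟩
      have := hincomp P (Finset.mem_insert_of_mem hP) Q (Finset.mem_insert_self Q T) hPQ
      exact hQT (this ▸ hP)
    obtain ⟨e, heJ, heQ⟩ := SetLike.not_le_iff_exists.1 hle
    refine ⟨c + e.totalDegree, fun t => ?_⟩
    have key := hilbertFn_add_le (I := ((insert Q T).inf id).restrictScalars K)
      (J := (T.inf id).restrictScalars K) (Q := Q.restrictScalars K)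
      (by rw [Finset.inf_insert]; exact fun x hx => hx.2) e
      (c := c + e.totalDegree) (Nat.le_add_left _ _)
      (fun a => Ideal.mul_mem_right a _ heJ) (fun a => by
        rw [Finset.inf_insert]
        exact ⟨fun h => (hQ.mem_or_mem h.1).resolve_left heQ,
          fun h => ⟨Ideal.mul_mem_left Q e h, Ideal.mul_mem_right a _ heJ⟩⟩) t
    have h₁ := hc t
    have h₂ := hilbertFn_mono ((T.inf id).restrictScalars K)
      (show t + c ≤ t + (c + e.totalDegree) by omega)
    have h₃ := hs Q (Finset.mem_insert_self Q T) t
    rw [Finset.card_insert_of_notMem hQT, add_mul, one_mul]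
    omega

theorem iterate_partialSum_mono (k : ℕ) {g h : ℕ → ℕ} (hgh : ∀ t, g t ≤ h t) (t : ℕ) :
    partialSum^[k] g t ≤ partialSum^[k] h t := by
  induction k generalizing t with
  | zero => exact hgh t
  | succ k ih =>
    rw [Function.iterate_succ_apply', Function.iterate_succ_apply']
    exact partialSum_mono ih t

theorem iterate_partialSum_mul (k c : ℕ) (h : ℕ → ℕ) :
    partialSum^[k] (fun j => c * h j) = fun t => c * partialSum^[k] h t := by
  induction k with
  | zero => rfl
  | succ k ih =>
    rw [Function.iterate_succ_apply', ih, Function.iterate_succ_apply']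
    exact funext fun t => partialSum_mul c _ t

theorem iterate_partialSum_le_prod_mul (h : ℕ → ℕ → ℕ) (d : ℕ → ℕ) (k : ℕ)
    (hd : ∀ i < k, ∀ t, partialSum (h (i + 1)) t ≤ d i * h i t) (t : ℕ) :
    partialSum^[k] (h k) t ≤ (∏ i ∈ Finset.range k, d i) * h 0 t := by
  induction k with
  | zero => simp
  | succ k ih =>
    have h₁ : partialSum^[k + 1] (h (k + 1)) t ≤ d k * partialSum^[k] (h k) t := by
      rw [Function.iterate_succ_apply]
      refine (iterate_partialSum_mono k (hd k (Nat.lt_succ_self k)) t).trans ?_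
      rw [iterate_partialSum_mul]
    have h₂ := ih fun i hi => hd i (hi.trans (Nat.lt_succ_self k))
    rw [Finset.prod_range_succ, mul_comm _ (d k), mul_assoc]
    exact h₁.trans (Nat.mul_le_mul_left _ h₂)

theorem mul_choose_le_iterate_partialSum {h : ℕ → ℕ} {r s c : ℕ} (k : ℕ)
    (hh : ∀ t, r * (t + s).choose s ≤ h (t + c)) (t : ℕ) :
    r * (t + (s + k)).choose (s + k) ≤ partialSum^[k] h (t + c) := by
  induction k generalizing t with
  | zero => exact hh t
  | succ k ih =>
    rw [Function.iterate_succ_apply', ← add_assoc s k 1, ← partialSum_choose, ← partialSum_mul]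
    exact (partialSum_mono ih t).trans (partialSum_shift_le _ c t)

/-- Both sides grow like `t ^ m / m!`, so the shift `c` disappears in the limit. -/
theorem le_of_forall_mul_choose_le {r D m c : ℕ}
    (h : ∀ t, r * (t + m).choose m ≤ D * (t + c + m).choose m) : r ≤ D := by
  have hpow : ∀ t, r * t ^ m ≤ D * (t + (c + m)) ^ m := fun t => by
    have h₁ : t ^ m ≤ (t + m).choose m * m.factorial := by
      rw [mul_comm, ← Nat.ascFactorial_eq_factorial_mul_choose]
      exact (Nat.pow_le_pow_left (Nat.le_succ t) m).trans (Nat.pow_succ_le_ascFactorial _ _)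
    have h₂ : (t + c + m).choose m * m.factorial ≤ (t + (c + m)) ^ m := by
      rw [mul_comm, ← Nat.ascFactorial_eq_factorial_mul_choose, ← add_assoc]
      exact Nat.ascFactorial_le_pow_add _ _
    calc r * t ^ m ≤ r * ((t + m).choose m * m.factorial) := by gcongr
      _ = r * (t + m).choose m * m.factorial := by ring
      _ ≤ D * (t + c + m).choose m * m.factorial := Nat.mul_le_mul_right _ (h t)
      _ = D * ((t + c + m).choose m * m.factorial) := by ring
      _ ≤ D * (t + (c + m)) ^ m := by gcongr
  have hlim : Filter.Tendsto (fun t : ℕ => (D : ℝ) * (1 + ((c + m : ℕ) : ℝ) / t) ^ m)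
      Filter.atTop (nhds ((D : ℝ) * (1 + 0) ^ m)) :=
    ((tendsto_const_nhds.add (tendsto_const_div_atTop_nhds_zero_nat _)).pow m).const_mul _
  rw [add_zero, one_pow, mul_one] at hlim
  have : (r : ℝ) ≤ D := by
    refine ge_of_tendsto hlim (Filter.eventually_atTop.2 ⟨1, fun t ht => ?_⟩)
    have ht' : (0 : ℝ) < t := by exact_mod_cast ht
    have hp : (r : ℝ) * (t : ℝ) ^ m ≤ D * ((t : ℝ) + ((c + m : ℕ) : ℝ)) ^ m := by
      exact_mod_cast hpow t
    rw [show 1 + ((c + m : ℕ) : ℝ) / t = (t + ((c + m : ℕ) : ℝ)) / t by field_simp, div_pow,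
      ← mul_div_assoc, le_div_iff₀ (by positivity)]
    exact hp
  exact_mod_cast this

/-- A polynomial of a system `f` of polynomials cannot vanish on a component of the zero set of
the earlier ones that contains a component of the expected dimension of the whole zero set. -/
theorem notMem_of_mem_minimalPrimes_of_le (f : ℕ → MvPolynomial (Fin m) K) {i k : ℕ} (hik : i < k)
    {P Q : Ideal (MvPolynomial (Fin m) K)} (hQ : Q ∈ (Ideal.span (f '' Set.Iio k)).minimalPrimes)
    (hdim : primeDim Q + k = m) (hP : P ∈ (Ideal.span (f '' Set.Iio i)).minimalPrimes)
    (hPQ : P ≤ Q) : f i ∉ P := by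
  classical
  intro hf
  have hPp : P.IsPrime := hP.1.1
  have hQp : Q.IsPrime := hQ.1.1
  -- Only `i` equations define `P`, so its dimension is at least `m - i`. If `f i` vanished on it,
  -- `k - i - 1` further equations would lead down to dimension `m - k`, forcing dimension at most
  -- `m - i - 1`.
  have h₁ : m ≤ primeDim P + i := by
    have := primeDim_le_add_card_of_mem_minimalPrimes (P := (⊥ : Ideal (MvPolynomial (Fin m) K)))
      ((Finset.range i).image f) (Q := P) (by simpa [bot_sup_eq] using hP)
    rw [primeDim_bot] at this
    exact this.trans (Nat.add_le_add_left (Finset.card_image_le.trans (by simp)) _)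
  have h₂ : primeDim P ≤ primeDim Q + (k - (i + 1)) := by
    have hmin : Q ∈ (P ⊔ Ideal.span (((Finset.Ico (i + 1) k).image f : Finset _) :
        Set (MvPolynomial (Fin m) K))).minimalPrimes := by
      have hsub : ∀ j < k, f j ∈ P ⊔ Ideal.span (((Finset.Ico (i + 1) k).image f : Finset _) :
          Set (MvPolynomial (Fin m) K)) := by
        intro j hj
        rcases lt_trichotomy j i with h | h | h
        · exact Ideal.mem_sup_left (hP.1.2 (Ideal.subset_span ⟨j, h, rfl⟩))
        · exact Ideal.mem_sup_left (h ▸ hf)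
        · refine Ideal.mem_sup_right (Ideal.subset_span ?_)
          exact Finset.mem_coe.2 (Finset.mem_image_of_mem f (Finset.mem_Ico.2 ⟨h, hj⟩))
      refine ⟨⟨hQp, sup_le hPQ (Ideal.span_le.2 ?_)⟩, fun J hJ hJQ => hQ.2 ⟨hJ.1, ?_⟩ hJQ⟩
      · intro x hx
        obtain ⟨j, hj, rfl⟩ := Finset.mem_image.1 (Finset.mem_coe.1 hx)
        exact hQ.1.2 (Ideal.subset_span ⟨j, (Finset.mem_Ico.1 hj).2, rfl⟩)
      · rw [Ideal.span_le]
        rintro _ ⟨j, hj, rfl⟩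
        exact hJ.2 (hsub j hj)
    refine (primeDim_le_add_card_of_mem_minimalPrimes _ hmin).trans
      (Nat.add_le_add_left (Finset.card_image_le.trans (by simp)) _)
  omega

/-- **Bézout's inequality**: the number of components of the expected dimension of the zero set of
a system of polynomials is at most the product of the degrees. -/
theorem card_le_prod_totalDegree (f : ℕ → MvPolynomial (Fin m) K) (d : ℕ → ℕ)
    (hpos : ∀ i, 0 < d i) (hd : ∀ i, (f i).totalDegree ≤ d i) (k : ℕ)
    (T : Finset (Ideal (MvPolynomial (Fin m) K)))
    (hT : ∀ Q ∈ T, Q ∈ (Ideal.span (f '' Set.Iio k)).minimalPrimes ∧ primeDim Q + k = m) :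
    T.card ≤ ∏ i ∈ Finset.range k, d i := by
  classical
  rcases T.eq_empty_or_nonempty with rfl | ⟨Q₀, hQ₀⟩
  · simp
  have hkm : k ≤ m := by have := (hT Q₀ hQ₀).2; omega
  -- Only components through some member of `T` are kept: these have the expected dimension, so `f
  -- i` is a nonzerodivisor modulo `J i` even if the whole system is not a complete intersection.
  let J : ℕ → Ideal (MvPolynomial (Fin m) K) := fun i =>
    sInf {P | P ∈ (Ideal.span (f '' Set.Iio i)).minimalPrimes ∧ ∃ Q ∈ T, P ≤ Q}
  have hJ : ∀ i a, a ∈ J i ↔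
      ∀ P ∈ (Ideal.span (f '' Set.Iio i)).minimalPrimes, ∀ Q ∈ T, P ≤ Q → a ∈ P := by
    intro i a
    simp only [J, Submodule.mem_sInf, Set.mem_ofPred_eq]
    exact ⟨fun h P hP Q hQ hPQ => h P ⟨hP, Q, hQ, hPQ⟩, fun h P ⟨hP, Q, hQ, hPQ⟩ => h P hP Q hQ hPQ⟩
  have hJk : T.inf id ≤ J k := fun a ha => (hJ k a).2 fun P hP Q hQ hPQ => by
    have hQ' := (hT Q hQ).1
    exact hQ'.2 hP.1 hPQ ((Finset.inf_le hQ : T.inf id ≤ Q) ha)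
  have hJk' : J k ≤ T.inf id := Finset.le_inf fun Q hQ a ha =>
    (hJ k a).1 ha Q (hT Q hQ).1 Q hQ le_rfl
  have hstep : ∀ i < k, ∀ t, partialSum (hilbertFn ((J (i + 1)).restrictScalars K)) t ≤
      d i * hilbertFn ((J i).restrictScalars K) t := by
    intro i hi t
    have hfi : f i ∈ J (i + 1) := (hJ _ _).2 fun P hP Q hQ hPQ =>
      hP.1.2 (Ideal.subset_span ⟨i, Nat.lt_succ_self i, rfl⟩)
    refine partialSum_hilbertFn_le ?_ (f i) (hd i) (hpos i)
      (fun a => Ideal.mul_mem_right a _ hfi) 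
      (fun a => ⟨fun h => ?_, fun h => Ideal.mul_mem_left (J i) _ h⟩) t
    · intro a ha
      refine (hJ _ _).2 fun P hP Q hQ hPQ => ?_
      have hPp : P.IsPrime := hP.1.1
      obtain ⟨P₀, hP₀, hP₀P⟩ := Ideal.exists_minimalPrimes_le
        (show Ideal.span (f '' Set.Iio i) ≤ P from
          (Ideal.span_mono (Set.image_mono (Set.Iio_subset_Iio (Nat.le_succ i)))).trans hP.1.2)
      exact hP₀P ((hJ i a).1 ha P₀ hP₀ Q hQ (hP₀P.trans hPQ))
    · refine (hJ _ _).2 fun P hP Q hQ hPQ => ?_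
      exact (hP.1.1.mem_or_mem ((hJ i _).1 h P hP Q hQ hPQ)).resolve_left
        (notMem_of_mem_minimalPrimes_of_le f hi (hT Q hQ).1 (hT Q hQ).2 hP hPQ)
  obtain ⟨c, hc⟩ := exists_card_mul_choose_le_hilbertFn T (m - k) (fun P hP => (hT P hP).1.1.1)
    (fun P hP Q hQ hPQ => le_antisymm hPQ ((hT Q hQ).1.2 (hT P hP).1.1 hPQ)) fun Q hQ t => by
      have : Q.IsPrime := (hT Q hQ).1.1.1
      obtain ⟨σ, hσ⟩ := exists_algebraicIndependent_of_primeDim Q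
      rw [show m - k = primeDim Q by have := (hT Q hQ).2; omega]
      exact choose_le_hilbertFn Q σ hσ t
  rw [le_antisymm hJk hJk'] at hc
  refine le_of_forall_mul_choose_le (m := m) (c := c) fun t => ?_
  have h₁ := mul_choose_le_iterate_partialSum k hc t
  rw [Nat.sub_add_cancel hkm] at h₁
  refine h₁.trans ((iterate_partialSum_le_prod_mul
    (fun i => hilbertFn ((J i).restrictScalars K)) d k hstep _).trans
      (Nat.mul_le_mul_left _ ?_))
  rw [← hilbertFn_bot (K := K) (m := m)]
  exact hilbertFn_anti bot_le _

end Bezout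

/-! ### Counting tuples of forms and subspaces over a finite field. -/

section Counting

/-- Union bound for sequential choices: a tuple is bad only if its prefix already is, or if the last
entry spoils a good prefix, which has probability at most `D / q`. -/
theorem card_filter_not_mul_le {α : Type*} [Fintype α] (G : ∀ i, (Fin i → α) → Prop)
    [∀ i, DecidablePred (G i)] (q D r : ℕ) (h0 : ∀ ℓ, G 0 ℓ)
    (hstep : ∀ i < r, ∀ ℓ, G i ℓ →
      (Finset.univ.filter fun a => ¬ G (i + 1) (Fin.snoc ℓ a)).card * q ≤ D * Fintype.card α)
    (i : ℕ) (hi : i ≤ r) :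
    (Finset.univ.filter fun ℓ => ¬ G i ℓ).card * q ≤ i * D * Fintype.card α ^ i := by
  induction i with
  | zero => simp [h0]
  | succ i ih =>
    have hsum : (Finset.univ.filter fun ℓ => ¬ G (i + 1) ℓ).card =
        ∑ ℓ : Fin i → α, (Finset.univ.filter fun a => ¬ G (i + 1) (Fin.snoc ℓ a)).card := by
      simp only [Finset.card_filter]
      rw [← (Fin.snocEquiv fun _ : Fin (i + 1) => α).sum_comp, Fintype.sum_prod_type_right]
      rfl
    have hterm : ∀ ℓ : Fin i → α,
        (Finset.univ.filter fun a => ¬ G (i + 1) (Fin.snoc ℓ a)).card * q ≤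
          D * Fintype.card α + (if ¬ G i ℓ then 1 else 0) * q * Fintype.card α := by
      intro ℓ
      by_cases hG : G i ℓ
      · simpa [hG] using hstep i hi ℓ hG
      · rw [if_pos hG, one_mul, mul_comm q]
        exact le_add_left (Nat.mul_le_mul_right q (Finset.card_le_univ _))
    have ih' := ih (Nat.le_of_succ_le hi)
    calc _ = ∑ ℓ : Fin i → α,
          (Finset.univ.filter fun a => ¬ G (i + 1) (Fin.snoc ℓ a)).card * q := by
            rw [hsum, Finset.sum_mul]
      _ ≤ ∑ ℓ : Fin i → α,
          (D * Fintype.card α + (if ¬ G i ℓ then 1 else 0) * q * Fintype.card α) :=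
            Finset.sum_le_sum fun ℓ _ => hterm ℓ
      _ = Fintype.card α ^ i * (D * Fintype.card α) +
          (Finset.univ.filter fun ℓ => ¬ G i ℓ).card * q * Fintype.card α := by
            rw [Finset.sum_add_distrib, ← Finset.sum_mul, ← Finset.sum_mul, ← Finset.sum_mul,
              ← Finset.card_filter]
            simp [mul_assoc]
      _ ≤ Fintype.card α ^ i * (D * Fintype.card α) +
          i * D * Fintype.card α ^ i * Fintype.card α := by gcongr
      _ = (i + 1) * D * Fintype.card α ^ (i + 1) := by ring

variable {F : Type*} [Field F] [Fintype F]

theorem card_submodule_mul_card_le {V : Type*} [AddCommGroup V] [Module F V] [Finite V]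
    {W : Submodule F V} (hW : W ≠ ⊤) : Nat.card W * Fintype.card F ≤ Nat.card V := by
  rw [Module.natCard_eq_pow_finrank (K := F) (V := W),
    Module.natCard_eq_pow_finrank (K := F) (V := V), Nat.card_eq_fintype_card, ← pow_succ]
  exact Nat.pow_le_pow_right Fintype.card_pos (Submodule.finrank_lt hW)

open Module in
-- Such tuples are the ordered bases of the annihilator of `L`, so their number does not depend on
-- `L`.
theorem natCard_linearIndependent_dualCoannihilator {V : Type*} [AddCommGroup V] [Module F V]
    [Finite V] {r : ℕ} (L : Submodule F V) (hL : finrank F L + r = finrank F V) :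
    Nat.card {ℓ : Fin r → Dual F V // LinearIndependent F ℓ ∧
      (Submodule.span F (Set.range ℓ)).dualCoannihilator = L} =
      ∏ i : Fin r, (Fintype.card F ^ r - Fintype.card F ^ (i : ℕ)) := by
  have hr : finrank F L.dualAnnihilator = r := by
    have := Subspace.finrank_add_finrank_dualAnnihilator_eq L
    omega
  have : Finite (Dual F V) := Module.finite_of_finite F
  have hcard := card_linearIndependent (K := F) (V := L.dualAnnihilator) (k := r) hr.ge
  rw [hr] at hcard
  rw [← hcard]
  refine Nat.card_congr
    { toFun := fun ℓ => ⟨fun i => ⟨ℓ.1 i, ?_⟩, ?_⟩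
      invFun := fun s => ⟨fun i => s.1 i, ?_, ?_⟩
      left_inv := fun _ => rfl
      right_inv := fun _ => rfl }
  · exact Submodule.dualAnnihilator_anti ℓ.2.2.ge
      (Submodule.le_dualCoannihilator_dualAnnihilator _ (Submodule.subset_span ⟨i, rfl⟩))
  · exact LinearIndependent.of_comp L.dualAnnihilator.subtype ℓ.2.1
  · exact s.2.map' L.dualAnnihilator.subtype (Submodule.ker_subtype _)
  · have hs : LinearIndependent F fun i => (s.1 i : Dual F V) :=
      s.2.map' L.dualAnnihilator.subtype (Submodule.ker_subtype _)
    have hspan : Submodule.span F (Set.range fun i => (s.1 i : Dual F V)) = L.dualAnnihilator := by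
      refine Submodule.eq_of_le_of_finrank_eq (Submodule.span_le.2 ?_) ?_
      · rintro _ ⟨i, rfl⟩
        exact (s.1 i).2
      · rw [finrank_span_eq_card hs, hr, Fintype.card_fin]
    rw [hspan, Subspace.dualAnnihilator_dualCoannihilator_eq]

open Module in
theorem natCard_linearIndependent_mk'_mem {V : Type*} [AddCommGroup V] [Module F V] [Finite V]
    {r k : ℕ} (hk : k + r = finrank F V) (v : V) (Y : Set (AffineSubspace F V))
    (hY : ∀ A ∈ Y, v ∈ A ∧ finrank F A.direction = k) :
    Nat.card {ℓ : Fin r → Dual F V // LinearIndependent F ℓ ∧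
      AffineSubspace.mk' v (Submodule.span F (Set.range ℓ)).dualCoannihilator ∈ Y} =
      Y.ncard * ∏ i : Fin r, (Fintype.card F ^ r - Fintype.card F ^ (i : ℕ)) := by
  have : Finite (Dual F V) := Module.finite_of_finite F
  have : Finite (AffineSubspace F V) := Finite.of_injective _ SetLike.coe_injective
  have : Fintype Y := Fintype.ofFinite Y
  have hfib : ∀ A : Y, Nat.card {ℓ : Fin r → Dual F V // LinearIndependent F ℓ ∧
      (Submodule.span F (Set.range ℓ)).dualCoannihilator = A.1.direction} =
      ∏ i : Fin r, (Fintype.card F ^ r - Fintype.card F ^ (i : ℕ)) := fun A =>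
    natCard_linearIndependent_dualCoannihilator A.1.direction (by rw [(hY A.1 A.2).2, hk])
  have e : {ℓ : Fin r → Dual F V // LinearIndependent F ℓ ∧
      AffineSubspace.mk' v (Submodule.span F (Set.range ℓ)).dualCoannihilator ∈ Y} ≃
      Σ A : Y, {ℓ : Fin r → Dual F V // LinearIndependent F ℓ ∧
        (Submodule.span F (Set.range ℓ)).dualCoannihilator = A.1.direction} :=
    { toFun := fun ℓ => ⟨⟨_, ℓ.2.2⟩, ℓ.1, ℓ.2.1, (AffineSubspace.direction_mk' _ _).symm⟩
      invFun := fun x => ⟨x.2.1, x.2.2.1, by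
        rw [x.2.2.2, AffineSubspace.mk'_eq (hY x.1.1 x.1.2).1]
        exact x.1.2⟩
      left_inv := fun _ => rfl
      right_inv := by
        rintro ⟨⟨A, hA⟩, ℓ, hℓ, h⟩
        have : AffineSubspace.mk' v (Submodule.span F (Set.range ℓ)).dualCoannihilator = A := by
          rw [h, AffineSubspace.mk'_eq (hY A hA).1]
        subst this
        rfl }
  rw [Nat.card_congr e, Nat.card_sigma, Finset.sum_congr rfl fun A _ => hfib A]
  rw [Finset.sum_const, smul_eq_mul, Finset.card_univ, ← Nat.card_eq_fintype_card,
    Nat.card_coe_set_eq]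

end Counting

/-! ### Random hyperplanes through `v` and the sampling bound. -/

namespace VarietySampling

open Module

variable {F : Type*} [Field F] {n k : ℕ}

/-- The polynomial `φ(x - v)` with coefficients in an extension `K` of `F`, for `φ` a linear form
over `F`. -/
noncomputable def hyperplane (K : Type*) [Field K] [Algebra F K] (v : Fin n → F) :
    Dual F (Fin n → F) →ₗ[F] MvPolynomial (Fin n) K where
  toFun φ := ∑ i, φ (Pi.single i 1) • (X i - C (algebraMap F K (v i)))
  map_add' φ ψ := by simp [add_smul, Finset.sum_add_distrib]
  map_smul' c φ := by simp [mul_smul, Finset.smul_sum]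

section

variable {K : Type*} [Field K] [Algebra F K]

theorem hyperplane_apply (v : Fin n → F) (φ : Dual F (Fin n → F)) :
    hyperplane K v φ = ∑ i, φ (Pi.single i 1) • (X i - C (algebraMap F K (v i))) := rfl

theorem totalDegree_hyperplane_le (v : Fin n → F) (φ : Dual F (Fin n → F)) :
    (hyperplane K v φ).totalDegree ≤ 1 := by
  rw [hyperplane_apply]
  refine totalDegree_finsetSum_le fun i _ => (totalDegree_smul_le _ _).trans ?_
  refine (totalDegree_sub _ _).trans ?_
  simp

theorem aeval_hyperplane (v : Fin n → F) (φ : Dual F (Fin n → F)) (x : Fin n → K) :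
    aeval x (hyperplane K v φ) = ∑ i, φ (Pi.single i 1) • (x i - algebraMap F K (v i)) := by
  simp [hyperplane_apply, Algebra.smul_def, algebraMap_eq,
    IsScalarTower.algebraMap_apply F K (MvPolynomial (Fin n) K)]

theorem aeval_hyperplane_algebraMap (v w : Fin n → F) (φ : Dual F (Fin n → F)) :
    aeval (fun i => algebraMap F K (w i)) (hyperplane K v φ) = algebraMap F K (φ (w - v)) := by
  have : φ (w - v) = ∑ i, φ (Pi.single i 1) * (w i - v i) := by
    conv_lhs => rw [← LinearMap.sum_single_apply _ (w - v)]
    rw [map_sum]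
    refine Finset.sum_congr rfl fun i _ => ?_
    rw [← mul_comm (w i - v i), ← smul_eq_mul, ← map_smul, ← Pi.single_smul]
    simp
  rw [aeval_hyperplane, this]
  simp [Algebra.smul_def]

theorem aeval_hyperplane_of_mem_baseChange (v : Fin n → F) {A : AffineSubspace F (Fin n → F)}
    (hv : v ∈ A) {φ : Dual F (Fin n → F)} (hφ : φ ∈ A.direction.dualAnnihilator)
    {x : Fin n → K} (hx : x ∈ baseChange K A) : aeval x (hyperplane K v φ) = 0 := by
  refine affineSpan_induction (p := fun x => aeval x (hyperplane K v φ) = 0) hx ?_ ?_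
  · rintro _ ⟨w, hw, rfl⟩
    have := (Submodule.mem_dualAnnihilator φ).1 hφ _ (AffineSubspace.vsub_mem_direction hw hv)
    rw [aeval_hyperplane_algebraMap, ← vsub_eq_sub, this, map_zero]
  · intro c x y z hx hy hz
    rw [aeval_hyperplane] at hx hy hz ⊢
    have : ∀ i, φ (Pi.single i 1) • ((c • (x -ᵥ y) +ᵥ z) i - algebraMap F K (v i)) =
        c * (φ (Pi.single i 1) • (x i - algebraMap F K (v i))) -
          c * (φ (Pi.single i 1) • (y i - algebraMap F K (v i))) +
          φ (Pi.single i 1) • (z i - algebraMap F K (v i)) := by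
      intro i
      simp only [vsub_eq_sub, vadd_eq_add, Pi.add_apply, Pi.smul_apply, Pi.sub_apply, smul_eq_mul,
        Algebra.smul_def (A := K)]
      ring
    simp only [this, Finset.sum_add_distrib, Finset.sum_sub_distrib, ← Finset.mul_sum, hx, hy, hz]
    simp

/-- The coordinate forms already generate the maximal ideal of the point `v`. -/
theorem primeDim_eq_zero_of_forall_hyperplane_mem (v : Fin n → F)
    (Q : Ideal (MvPolynomial (Fin n) K)) [hQ : Q.IsPrime]
    (h : ∀ φ : Dual F (Fin n → F), hyperplane K v φ ∈ Q) : primeDim Q = 0 := by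
  have hX : ∀ i, X i - C (algebraMap F K (v i)) ∈ Q := fun i => by
    have := h (LinearMap.proj i)
    rw [hyperplane_apply, Finset.sum_eq_single i] at this
    · simpa using this
    · intro j _ hj
      simp [hj.symm]
    · simp
  let x : Fin n → K := fun i => algebraMap F K (v i)
  have hmk : Ideal.Quotient.mkₐ K Q =
      (Algebra.ofId K (MvPolynomial (Fin n) K ⧸ Q)).comp (aeval x) := by
    refine algHom_ext fun i => ?_
    have := hX i
    rw [← Ideal.Quotient.eq_zero_iff_mem, map_sub, sub_eq_zero] at this
    rw [AlgHom.comp_apply, aeval_X]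
    exact this
  have hle : vanishingIdeal K {x} ≤ Q := fun p hp => by
    rw [mem_vanishingIdeal_singleton_iff] at hp
    have := congrArg (fun g => g p) hmk
    simp only [AlgHom.comp_apply, hp, map_zero, Ideal.Quotient.mkₐ_eq_mk] at this
    exact Ideal.Quotient.eq_zero_iff_mem.1 this
  have hmax : (vanishingIdeal K {x} : Ideal (MvPolynomial (Fin n) K)).IsMaximal := inferInstance
  obtain rfl := hmax.eq_of_le hQ.ne_top hle
  have hz := ringKrullDim_eq_zero_of_isField
    ((Ideal.Quotient.maximal_ideal_iff_isField_quotient _).1 hmax)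
  rw [← coe_primeDim] at hz
  exact_mod_cast hz

/-- The ideal of the intersection of the variety defined by `f` with hyperplanes through `v`. -/
noncomputable def cutIdeal (K : Type*) [Field K] [Algebra F K]
    (f : Fin k → MvPolynomial (Fin n) F) (v : Fin n → F) {r : ℕ}
    (ℓ : Fin r → Dual F (Fin n → F)) : Ideal (MvPolynomial (Fin n) K) :=
  Ideal.span (Set.range fun i => map (algebraMap F K) (f i)) ⊔
    Ideal.span (Set.range fun i => hyperplane K v (ℓ i))

/-- The hyperplanes `ℓ` through `v` cut the variety defined by `f` in the expected dimension. -/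
def IsProperCut (K : Type*) [Field K] [Algebra F K]
    (f : Fin k → MvPolynomial (Fin n) F) (v : Fin n → F) {r : ℕ}
    (ℓ : Fin r → Dual F (Fin n → F)) : Prop :=
  ∀ P : Ideal (MvPolynomial (Fin n) K), P.IsPrime → cutIdeal K f v ℓ ≤ P →
    primeDim P + (k + r) ≤ n

theorem cutIdeal_snoc (f : Fin k → MvPolynomial (Fin n) F) (v : Fin n → F) {r : ℕ}
    (ℓ : Fin r → Dual F (Fin n → F)) (φ : Dual F (Fin n → F)) :
    cutIdeal K f v (Fin.snoc ℓ φ : Fin (r + 1) → Dual F (Fin n → F)) =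
      cutIdeal K f v ℓ ⊔ Ideal.span {hyperplane K v φ} := by
  have : (Set.range fun i => hyperplane K v
      ((Fin.snoc ℓ φ : Fin (r + 1) → Dual F (Fin n → F)) i)) =
      insert (hyperplane K v φ) (Set.range fun i => hyperplane K v (ℓ i)) := by
    ext p
    simp only [Set.mem_range, Set.mem_insert_iff, Fin.exists_fin_succ', Fin.snoc_castSucc,
      Fin.snoc_last]
    rw [or_comm, eq_comm]
  rw [cutIdeal, this, Ideal.span_insert, cutIdeal, sup_comm (Ideal.span {hyperplane K v φ}),
    sup_assoc]

/-- Bézout for the concatenated system; the hyperplanes contribute factors 1, so the bound is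
independent of `r`. -/
theorem card_minimalPrimes_cutIdeal_le (f : Fin k → MvPolynomial (Fin n) F) {d : ℕ} (hd : 0 < d)
    (hf : ∀ i, (f i).totalDegree ≤ d) (v : Fin n → F) {r : ℕ} (ℓ : Fin r → Dual F (Fin n → F))
    (T : Finset (Ideal (MvPolynomial (Fin n) K)))
    (hT : ∀ Q ∈ T, Q ∈ (cutIdeal K f v ℓ).minimalPrimes ∧ primeDim Q + (k + r) = n) :
    T.card ≤ d ^ k := by
  let g : ℕ → MvPolynomial (Fin n) K := fun j =>
    if h : j < k then map (algebraMap F K) (f ⟨j, h⟩)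
    else if h : j - k < r then hyperplane K v (ℓ ⟨j - k, h⟩) else 0
  let e : ℕ → ℕ := fun j => if j < k then d else 1
  have hspan : Ideal.span (g '' Set.Iio (k + r)) = cutIdeal K f v ℓ := by
    rw [cutIdeal, ← Ideal.span_union]
    congr 1
    ext p
    constructor
    · rintro ⟨j, hj, rfl⟩
      have hj' : j < k + r := hj
      by_cases h : j < k
      · exact Or.inl ⟨⟨j, h⟩, by simp [g, h]⟩
      · exact Or.inr ⟨⟨j - k, by omega⟩, by simp [g, h, show j - k < r by omega]⟩
    · rintro (⟨i, rfl⟩ | ⟨i, rfl⟩)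
      · exact ⟨i, Set.mem_Iio.2 (by omega), by simp [g]⟩
      · exact ⟨k + i, Set.mem_Iio.2 (by omega), by simp [g]⟩
  have hg : ∀ j, (g j).totalDegree ≤ e j := by
    intro j
    by_cases h : j < k
    · simp only [g, e, h, dif_pos, if_pos]
      exact (Finset.sup_mono (support_map_subset _ _)).trans (hf ⟨j, h⟩)
    · simp only [g, e, h, dif_neg, if_neg, not_false_eq_true]
      split_ifs
      · exact totalDegree_hyperplane_le _ _
      · simp
  have := card_le_prod_totalDegree g e (fun j => by simp only [e]; split_ifs <;> omega) hg (k + r) T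
    (by rwa [hspan])
  rw [Finset.prod_range_add, Finset.prod_congr rfl (g := fun _ => d)
    (fun j hj => by simp [e, Finset.mem_range.1 hj])] at this
  simpa [e] using this

open Classical in
theorem card_not_isProperCut_snoc_mul_le [Fintype F] (f : Fin k → MvPolynomial (Fin n) F) {d : ℕ}
    (hd : 0 < d) (hf : ∀ i, (f i).totalDegree ≤ d) (v : Fin n → F) {r : ℕ} (hr : k + r < n)
    (ℓ : Fin r → Dual F (Fin n → F)) (hℓ : IsProperCut K f v ℓ) (hind : LinearIndependent F ℓ)
    [Fintype (Dual F (Fin n → F))] :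
    (Finset.univ.filter fun φ => ¬ (LinearIndependent F
        (Fin.snoc ℓ φ : Fin (r + 1) → Dual F (Fin n → F)) ∧
      IsProperCut K f v (Fin.snoc ℓ φ : Fin (r + 1) → Dual F (Fin n → F)))).card * Fintype.card F ≤
      (d ^ k + 1) * Fintype.card (Dual F (Fin n → F)) := by
  have hfin : {Q | Q ∈ (cutIdeal K f v ℓ).minimalPrimes ∧ primeDim Q + (k + r) = n}.Finite :=
    (Ideal.finite_minimalPrimes_of_isNoetherianRing _ _).subset fun Q hQ => hQ.1
  let T := hfin.toFinset
  have hT : ∀ Q ∈ T, Q ∈ (cutIdeal K f v ℓ).minimalPrimes ∧ primeDim Q + (k + r) = n := fun Q hQ =>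
    hfin.mem_toFinset.1 hQ
  let W : Ideal (MvPolynomial (Fin n) K) → Submodule F (Dual F (Fin n → F)) := fun Q =>
    (Q.restrictScalars F).comap (hyperplane K v)
  have hW : ∀ Q ∈ T, (Finset.univ.filter (· ∈ W Q)).card * Fintype.card F ≤
      Fintype.card (Dual F (Fin n → F)) := by
    intro Q hQ
    have hQp : Q.IsPrime := (hT Q hQ).1.1.1
    have hne : W Q ≠ ⊤ := fun htop => by
      have := primeDim_eq_zero_of_forall_hyperplane_mem v Q fun φ =>
        (htop ▸ Submodule.mem_top : φ ∈ W Q)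
      have := (hT Q hQ).2
      omega
    have := card_submodule_mul_card_le hne
    rwa [Nat.card_eq_fintype_card, Nat.card_eq_fintype_card, Fintype.card_subtype] at this
  have hS : (Finset.univ.filter (· ∈ Submodule.span F (Set.range ℓ))).card * Fintype.card F ≤
      Fintype.card (Dual F (Fin n → F)) := by
    have hne : Submodule.span F (Set.range ℓ) ≠ ⊤ := fun htop => by
      have h₁ := finrank_span_eq_card hind
      rw [htop, finrank_top, Subspace.dual_finrank_eq] at h₁
      simp at h₁
      omega
    have := card_submodule_mul_card_le hne
    rwa [Nat.card_eq_fintype_card, Nat.card_eq_fintype_card, Fintype.card_subtype] at this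
  have hsub : (Finset.univ.filter fun φ => ¬ (LinearIndependent F
        (Fin.snoc ℓ φ : Fin (r + 1) → Dual F (Fin n → F)) ∧
      IsProperCut K f v (Fin.snoc ℓ φ : Fin (r + 1) → Dual F (Fin n → F)))) ⊆
      (T.biUnion fun Q => Finset.univ.filter (· ∈ W Q)) ∪
        Finset.univ.filter (· ∈ Submodule.span F (Set.range ℓ)) := by
    intro φ hφ
    by_contra hcon
    simp only [Finset.mem_union, Finset.mem_biUnion, Finset.mem_filter, Finset.mem_univ, true_and,
      not_or, not_exists, not_and] at hcon
    refine (Finset.mem_filter.1 hφ).2 ⟨linearIndependent_finSnoc.2 ⟨hind, hcon.2⟩, fun P hP hle => ?_⟩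
    rw [cutIdeal_snoc] at hle
    obtain ⟨Q, hQ, hQP⟩ := Ideal.exists_minimalPrimes_le (le_sup_left.trans hle)
    have hQp : Q.IsPrime := hQ.1.1
    have hφP : hyperplane K v φ ∈ P := hle (Ideal.mem_sup_right (Ideal.mem_span_singleton_self _))
    have hQn := hℓ Q hQp hQ.1.2
    -- If `P` is itself a component, it contains the new form and so is not of top dimension;
    -- otherwise it is strictly smaller than a component. Either way one dimension is gained.
    rcases hQP.eq_or_lt with rfl | hlt
    · have : primeDim Q + (k + r) ≠ n := fun h => hcon.1 Q (hfin.mem_toFinset.2 ⟨hQ, h⟩) hφP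
      omega
    · have := primeDim_lt_of_lt hlt
      omega
  calc _ ≤ (∑ Q ∈ T, (Finset.univ.filter (· ∈ W Q)).card +
        (Finset.univ.filter (· ∈ Submodule.span F (Set.range ℓ))).card) * Fintype.card F := by
          gcongr
          exact (Finset.card_le_card hsub).trans ((Finset.card_union_le _ _).trans
            (Nat.add_le_add_right Finset.card_biUnion_le _))
    _ = ∑ Q ∈ T, (Finset.univ.filter (· ∈ W Q)).card * Fintype.card F +
        (Finset.univ.filter (· ∈ Submodule.span F (Set.range ℓ))).card * Fintype.card F := by
          rw [add_mul, Finset.sum_mul]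
    _ ≤ ∑ Q ∈ T, Fintype.card (Dual F (Fin n → F)) + Fintype.card (Dual F (Fin n → F)) :=
          Nat.add_le_add (Finset.sum_le_sum hW) hS
    _ = (T.card + 1) * Fintype.card (Dual F (Fin n → F)) := by
          rw [Finset.sum_const, smul_eq_mul]
          ring
    _ ≤ _ := by
          gcongr
          exact card_minimalPrimes_cutIdeal_le f hd hf v ℓ T hT

end

/-- By the Nullstellensatz the vanishing ideal is the radical of the defining ideal, so every prime
over the equations contains it. -/
theorem HasCodimension.isProperCut {f : Fin k → MvPolynomial (Fin n) F} (h : HasCodimension f k)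
    (v : Fin n → F) (ℓ : Fin 0 → Dual F (Fin n → F)) :
    IsProperCut (AlgebraicClosure F) f v ℓ := by
  intro P hP hle
  have hV : vanishingIdeal (AlgebraicClosure F) (points (AlgebraicClosure F) f) ≤ P := by
    have hz : points (AlgebraicClosure F) f = zeroLocus (AlgebraicClosure F) (Ideal.span
        (Set.range fun i => map (algebraMap F (AlgebraicClosure F)) (f i))) := by
      rw [zeroLocus_span]
      ext x
      simp only [points, Set.mem_ofPred_eq, Set.forall_mem_range, aeval_map_algebraMap]
    rw [hz, vanishingIdeal_zeroLocus_eq_radical, hP.radical_le_iff]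
    exact le_sup_left.trans hle
  have hdim := ringKrullDim_le_of_surjective _ (Ideal.Quotient.factor_surjective hV)
  rw [← coe_primeDim] at hdim
  have : (primeDim P : WithBot ℕ∞) + k ≤ n := by
    rw [← h]
    gcongr
    exact hdim
  exact_mod_cast this

/-- With `k + r = n` every prime over the cut has dimension 0 and is therefore maximal; the point
`v` keeps the intersection nonempty. -/
theorem IsProperCut.properlyIntersects {f : Fin k → MvPolynomial (Fin n) F} {v : Fin n → F}
    (hv : v ∈ points F f) {r : ℕ} (hr : k + r = n) {ℓ : Fin r → Dual F (Fin n → F)}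
    (h : IsProperCut (AlgebraicClosure F) f v ℓ) :
    ProperlyIntersects
      (AffineSubspace.mk' v (Submodule.span F (Set.range ℓ)).dualCoannihilator) f := by
  set A := AffineSubspace.mk' v (Submodule.span F (Set.range ℓ)).dualCoannihilator with hA
  have hvA : v ∈ A := AffineSubspace.self_mem_mk' _ _
  refine ⟨⟨v, hv, hvA⟩, ?_⟩
  set S := points (AlgebraicClosure F) f ∩
    (baseChange (AlgebraicClosure F) A : Set (Fin n → AlgebraicClosure F)) with hS
  have hvS : (fun i => algebraMap F (AlgebraicClosure F) (v i)) ∈ S := by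
    refine ⟨fun i => ?_, subset_affineSpan _ _ ⟨v, hvA, rfl⟩⟩
    have := aeval_algebraMap_apply (AlgebraicClosure F) v (f i)
    rw [hv i, map_zero] at this
    exact this
  have hcut : cutIdeal (AlgebraicClosure F) f v ℓ ≤ vanishingIdeal (AlgebraicClosure F) S := by
    refine sup_le (Ideal.span_le.2 ?_) (Ideal.span_le.2 ?_)
    · rintro _ ⟨i, rfl⟩ x hx
      rw [aeval_map_algebraMap]
      exact hx.1 i
    · rintro _ ⟨i, rfl⟩ x hx
      refine aeval_hyperplane_of_mem_baseChange v hvA ?_ hx.2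
      rw [hA, AffineSubspace.direction_mk']
      exact Submodule.le_dualCoannihilator_dualAnnihilator _ (Submodule.subset_span ⟨i, rfl⟩)
  have hne : vanishingIdeal (AlgebraicClosure F) S ≠ ⊤ := fun htop => by
    have : (1 : MvPolynomial (Fin n) (AlgebraicClosure F)) ∈
        vanishingIdeal (AlgebraicClosure F) S := htop ▸ Submodule.mem_top
    simpa using this _ hvS
  have hnt := Ideal.Quotient.nontrivial_iff.2 hne
  rw [dimension, ← ringKrullDimZero_iff_ringKrullDim_eq_zero,
    Ideal.krullDimLE_zero_quotient_iff_forall_minimalPrimes_isMaximal]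
  intro P hP
  have hPp : P.IsPrime := hP.1.1
  have h0 := h P hPp (hcut.trans hP.1.2)
  obtain ⟨M, hM, hPM⟩ := Ideal.exists_le_maximal P hPp.ne_top
  rcases hPM.eq_or_lt with rfl | hlt
  · exact hM
  · have := primeDim_lt_of_lt hlt
    omega

open Classical in
theorem one_sub_le_ncard_properlyIntersects_div [Fintype F] {d : ℕ} (hd : 0 < d)
    (f : Fin k → MvPolynomial (Fin n) F) (hf : ∀ i, (f i).totalDegree ≤ d)
    (hcodim : HasCodimension f k) {v : Fin n → F} (hv : v ∈ points F f) :
    1 - ((n * (d ^ k + 1) : ℕ) : ℝ) / (Fintype.card F : ℝ) ≤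
      (({A ∈ spacesThrough k v | ProperlyIntersects A f}.ncard : ℕ) : ℝ) /
        ((spacesThrough k v).ncard : ℝ) := by
  -- The maximal ideal of `v` is a prime over the equations, and its dimension is at least 0.
  have hkn : k ≤ n := by
    have hpt : (fun i => algebraMap F (AlgebraicClosure F) (v i)) ∈
        points (AlgebraicClosure F) f := fun i => by
      have := aeval_algebraMap_apply (AlgebraicClosure F) v (f i)
      rw [hv i, map_zero] at this
      exact this
    have hP := hcodim.isProperCut v Fin.elim0 (vanishingIdeal (AlgebraicClosure F)
      {fun i => algebraMap F (AlgebraicClosure F) (v i)}) inferInstance (sup_le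
        (Ideal.span_le.2 (by
          rintro _ ⟨i, rfl⟩ x rfl
          rw [aeval_map_algebraMap]
          exact hpt i))
        (Ideal.span_le.2 (by rintro _ ⟨i, rfl⟩; exact i.elim0)))
    omega
  obtain ⟨r, rfl⟩ : ∃ r, n = k + r := ⟨n - k, by omega⟩
  set q := Fintype.card F with hq
  have hq0 : (0 : ℝ) < q := by exact_mod_cast (Fintype.card_pos : 0 < Fintype.card F)
  have : Finite (Dual F (Fin (k + r) → F)) := Module.finite_of_finite F
  have : Fintype (Dual F (Fin (k + r) → F)) := Fintype.ofFinite _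
  set N := Fintype.card (Dual F (Fin (k + r) → F)) with hN
  set Nb := ∏ i : Fin r, (q ^ r - q ^ (i : ℕ))
  let G : ∀ i, (Fin i → Dual F (Fin (k + r) → F)) → Prop := fun i ℓ =>
    LinearIndependent F ℓ ∧ IsProperCut (AlgebraicClosure F) f v ℓ
  have hbad : (Finset.univ.filter fun ℓ => ¬ G r ℓ).card * q ≤ r * (d ^ k + 1) * N ^ r :=
    card_filter_not_mul_le G q (d ^ k + 1) r
      (fun ℓ => ⟨linearIndependent_empty_type, hcodim.isProperCut v ℓ⟩)
      (fun i hi ℓ hℓ => card_not_isProperCut_snoc_mul_le f hd hf v (by omega) ℓ hℓ.2 hℓ.1) r le_rfl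
  have hsplit : (Finset.univ.filter fun ℓ => G r ℓ).card +
      (Finset.univ.filter fun ℓ => ¬ G r ℓ).card = N ^ r := by
    rw [Finset.card_filter_add_card_filter_not, Finset.card_univ]
    simp [hN]
  have hfr : k + r = finrank F (Fin (k + r) → F) := by simp
  -- An inequality suffices, because dependent tuples were counted as bad.
  have htot : (spacesThrough k v).ncard * Nb ≤ N ^ r := by
    rw [← natCard_linearIndependent_mk'_mem hfr v (spacesThrough k v) fun A hA => hA]
    refine (Finite.card_subtype_le _).trans ?_
    simp [hN, Nat.card_eq_fintype_card]
  have hgood : (Finset.univ.filter fun ℓ => G r ℓ).card ≤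
      {A ∈ spacesThrough k v | ProperlyIntersects A f}.ncard * Nb := by
    rw [← natCard_linearIndependent_mk'_mem hfr v _ fun A hA => hA.1, Nat.card_eq_fintype_card,
      Fintype.card_subtype]
    refine Finset.card_le_card fun ℓ hℓ => ?_
    simp only [Finset.mem_filter, Finset.mem_univ, true_and] at hℓ ⊢
    refine ⟨hℓ.1, ⟨AffineSubspace.self_mem_mk' _ _, ?_⟩, hℓ.2.properlyIntersects hv rfl⟩
    rw [AffineSubspace.direction_mk']
    have h₁ := finrank_span_eq_card hℓ.1
    have h₂ := Subspace.finrank_add_finrank_dualCoannihilator_eq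
      (Submodule.span F (Set.range ℓ))
    rw [h₁, ← hfr, Fintype.card_fin] at h₂
    omega
  rcases le_or_gt (1 - (((k + r) * (d ^ k + 1) : ℕ) : ℝ) / (q : ℝ)) 0 with hneg | hpos
  · exact hneg.trans (by positivity)
  have hNpos : (0 : ℝ) < (N : ℝ) ^ r := by
    have : 0 < N := Fintype.card_pos
    positivity
  have hbad' : ((Finset.univ.filter fun ℓ => ¬ G r ℓ).card : ℝ) * q ≤
      r * ((d : ℝ) ^ k + 1) * N ^ r := by exact_mod_cast hbad
  have hsplit' : ((Finset.univ.filter fun ℓ => G r ℓ).card : ℝ) +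
      ((Finset.univ.filter fun ℓ => ¬ G r ℓ).card : ℝ) = N ^ r := by exact_mod_cast hsplit
  have htot' : ((spacesThrough k v).ncard : ℝ) * Nb ≤ N ^ r := by exact_mod_cast htot
  have hgood' : ((Finset.univ.filter fun ℓ => G r ℓ).card : ℝ) ≤
      ({A ∈ spacesThrough k v | ProperlyIntersects A f}.ncard : ℝ) * Nb := by exact_mod_cast hgood
  have hlow : (1 - (((k + r) * (d ^ k + 1) : ℕ) : ℝ) / (q : ℝ)) * N ^ r ≤
      ({A ∈ spacesThrough k v | ProperlyIntersects A f}.ncard : ℝ) * Nb := by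
    refine le_trans ?_ hgood'
    have h₁ : ((Finset.univ.filter fun ℓ => ¬ G r ℓ).card : ℝ) ≤
        (((k + r) * (d ^ k + 1) : ℕ) : ℝ) / (q : ℝ) * N ^ r := by
      rw [div_mul_eq_mul_div, le_div_iff₀ hq0]
      refine hbad'.trans ?_
      push_cast
      gcongr
      linarith [(Nat.cast_nonneg k : (0 : ℝ) ≤ k)]
    linarith
  -- Since the lower bound is strictly positive, `hlow` itself rules out zero denominators.
  have hNb : (0 : ℝ) < Nb := by
    by_contra hcon
    have hNb0 : (Nb : ℝ) = 0 := le_antisymm (not_lt.1 hcon) (Nat.cast_nonneg _)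
    rw [hNb0, mul_zero] at hlow
    exact absurd hlow (not_le.2 (mul_pos hpos hNpos))
  have hXpos : (0 : ℝ) < (spacesThrough k v).ncard := by
    have hY : (0 : ℝ) < ({A ∈ spacesThrough k v | ProperlyIntersects A f}.ncard : ℝ) := by
      by_contra hcon
      have h0 := mul_nonpos_of_nonpos_of_nonneg (not_lt.1 hcon) hNb.le
      exact absurd (hlow.trans h0) (not_le.2 (mul_pos hpos hNpos))
    have : Finite (AffineSubspace F (Fin (k + r) → F)) :=
      Finite.of_injective _ SetLike.coe_injective
    refine hY.trans_le ?_
    exact_mod_cast Set.ncard_le_ncard (Set.sep_subset _ _) (Set.toFinite _)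
  rw [le_div_iff₀ hXpos]
  refine le_of_mul_le_mul_right ?_ hNb
  refine le_trans ?_ hlow
  rw [mul_assoc]
  exact mul_le_mul_of_nonneg_left htot' hpos.le

end VarietySampling

theorem mainTheorem4 :
    ∃ B : ℕ → ℕ → ℕ → ℕ,
      (∀ k : ℕ, ∃ P : MvPolynomial (Fin 2) ℕ, ∀ n d : ℕ,
        B n d k ≤ MvPolynomial.eval ![n, d] P) ∧
      ∀ (n d k : ℕ), 0 < n → 0 < d → 0 < k →
      ∀ (F : Type*) [Field F] [Fintype F] (f : Fin k → MvPolynomial (Fin n) F),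
        (∀ i, (f i).totalDegree ≤ d) →
        VarietySampling.HasCodimension f k →
      ∀ v ∈ VarietySampling.points F f,
        1 - (B n d k : ℝ) / (Fintype.card F : ℝ) ≤
          (({A ∈ VarietySampling.spacesThrough k v |
              VarietySampling.ProperlyIntersects A f}.ncard : ℕ) : ℝ) /
            ((VarietySampling.spacesThrough k v).ncard : ℝ) := by
  refine ⟨fun n d k => n * (d ^ k + 1), fun k => ⟨X 0 * (X 1 ^ k + 1), fun n d => ?_⟩, ?_⟩
  · simp
  · intro n d k _ hd _ F _ _ f hf hcodim v hv
    exact VarietySampling.one_sub_le_ncard_properlyIntersects_div hd f hf hcodim hv
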